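/- Consider weighted deterministic submodular ranking: given a ground set $U=[n]$, functions $f_1,\dots,f_m:2^{U}\to\mathbb R_+$ that are monotone and submodular with $f_i(\emptyset)=0$ and $f_i(U)=1$, and weights $w_1,\dots,w_m\ge 0$ with $\sum_j w_j>0$, find a linear ordering of $U$ that minimizes $\sum_{i=1}^m w_i\,\tau_i$, where $\tau_i$ is the least $k$ such that $f_i$ is at least $1$ on the set of the first $k$ elements. Let $\epsilon>0$ be the minimum of all positive increments $f_i(A\cup\{e\})-f_i(A)$ over $i\in[m]$, $A\subseteq U$, $e\in U$. An instance of adaptive submodular ranking has elements $e\in U$ with costs $c_e>0$ and scenarios $i\in[m]$ with interest sets $S_i\subseteq U$, probabilities $p_i$, and normalized monotone submodular functions $f_i$ with $f_i(A)=f_i(A\cap S_i)$ and $f_i(S_i)=1$. The adaptive greedy algorithm keeps a state $(E,H)$, where $E$ is the set of elements displayed so far and $H$ is the set of scenarios that are compatible with the feedback received (whether $e\in S_{i^*}$, for each displayed $e$ and the realized scenario $i^*$) and are not yet covered. While $H\neq\emptyset$ it displays an element $e\in U\setminus E$ that maximizes $$\frac1{c_e}\Bigl(\sum_{j\in L_e(H)}p_j+\sum_{i\in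 H}p_i\,\frac{f_i(E\cup\{e\})-f_i(E)}{1-f_i(E)}\Bigr),$$ where $L_e(H)$ is the smaller of the sets $\{i\in H:e\in S_i\}$ and $\{i\in H:e\notin S_i\}$. Run this algorithm with $c_e=1$ for all $e$, with $S_i=U$ and the given $f_i$ for all $i$, and with $p_i=w_i/\sum_j w_j$; order the elements as they are displayed, followed by the remaining ones in any order. Then $L_e(H)=\emptyset$ for all $e\in U$ and $H\subseteq[m]$, and there is an absolute constant $C$ such that, however ties are broken, the objective value of the resulting ordering is at most $C\,(1+\ln\frac1\epsilon)$ times that of any linear ordering of $U$. Moreover, the algorithm can be implemented with a number of value-oracle queries and elementary operations (arithmetic on real numbers at unit cost) that is polynomial in $n+m$. Thus the algorithm is an $O(\log\frac1\epsilon)$-approximation algorithm for weighted deterministic submodular ranking. -/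

import Mathlib

/-! ### Adaptive submodular ranking and its greedy algorithm -/

/-- An instance of adaptive submodular ranking: elements `Fin n` with positive costs, scenarios
`Fin m` with interest sets `S i`, probabilities `p i`, and normalized monotone submodular
functions `f i`, extended to all sets of elements by `f i A = f i (A ∩ S i)`. -/
structure ASRInstance (n m : ℕ) where
  cost : Fin n → ℝ
  cost_pos : ∀ e, 0 < cost e
  S : Fin m → Finset (Fin n)
  f : Fin m → Finset (Fin n) → ℝ
  f_inter : ∀ i A, f i A = f i (A ∩ S i)
  f_mono : ∀ i A B, A ⊆ B → f i A ≤ f i B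
  f_submodular : ∀ i A B, f i (A ∩ B) + f i (A ∪ B) ≤ f i A + f i B
  f_empty : ∀ i, f i ∅ = 0
  f_S : ∀ i, f i (S i) = 1
  p : Fin m → ℝ
  p_nonneg : ∀ i, 0 ≤ p i
  p_sum : ∑ i, p i = 1

/-- Binary decision trees with nodes labelled by elements. -/
inductive DecisionTree (n : ℕ) where
  | leaf : DecisionTree n
  | node (e : Fin n) (yes no : DecisionTree n) : DecisionTree n

/-- The sequence of elements on the path traced by a scenario with interest set `S`: the
yes-branch is taken at elements of `S`, the no-branch at all others. -/
def DecisionTree.path {n : ℕ} (S : Finset (Fin n)) : DecisionTree n → List (Fin n)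
  | .leaf => []
  | .node e yes no => e :: (if e ∈ S then yes.path S else no.path S)

namespace ASRInstance

variable {n m : ℕ} (A : ASRInstance n m)

/-- `L_e(H)`: the smaller of `{i ∈ H : e ∈ S_i}` and `{i ∈ H : e ∉ S_i}`. -/
def light (e : Fin n) (H : Finset (Fin m)) : Finset (Fin m) :=
  if (H.filter fun i => e ∈ A.S i).card ≤ (H.filter fun i => e ∉ A.S i).card then
    H.filter fun i => e ∈ A.S i
  else
    H.filter fun i => e ∉ A.S i

/-- The greedy score of the element `e` at the state `(E, H)`. -/
noncomputable def score (E : Finset (Fin n)) (H : Finset (Fin m)) (e : Fin n) : ℝ :=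
  (1 / A.cost e) *
    (∑ j ∈ A.light e H, A.p j + ∑ i ∈ H, A.p i * ((A.f i (insert e E) - A.f i E) / (1 - A.f i E)))

/-- `A.IsGreedyTree E H T`: `T` is a decision tree that the greedy algorithm can produce from the
state `(E, H)`, where `E` is the set of displayed elements and `H` the set of compatible uncovered
scenarios. Ties between elements of maximum score are broken arbitrarily. -/
inductive IsGreedyTree :
    Finset (Fin n) → Finset (Fin m) → DecisionTree n → Prop
  | leaf (E : Finset (Fin n)) : IsGreedyTree E ∅ .leaf
  | node (E : Finset (Fin n)) (H : Finset (Fin m)) (e : Fin n) (yes no : DecisionTree n)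
      (hH : H.Nonempty) (he : e ∉ E)
      (hmax : ∀ e', e' ∉ E → A.score E H e' ≤ A.score E H e)
      (hyes : IsGreedyTree (insert e E)
        (H.filter fun i => e ∈ A.S i ∧ A.f i (insert e E) < 1) yes)
      (hno : IsGreedyTree (insert e E)
        (H.filter fun i => e ∉ A.S i ∧ A.f i (insert e E) < 1) no) :
      IsGreedyTree E H (.node e yes no)

end ASRInstance

/-! ### Deterministic submodular ranking -/

/-- An instance of weighted deterministic submodular ranking: `m` normalized monotone submodular
functions on the subsets of `Fin n`, with nonnegative weights that are not all zero. -/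
structure DSRInstance (n m : ℕ) where
  f : Fin m → Finset (Fin n) → ℝ
  f_mono : ∀ i A B, A ⊆ B → f i A ≤ f i B
  f_submodular : ∀ i A B, f i (A ∩ B) + f i (A ∪ B) ≤ f i A + f i B
  f_empty : ∀ i, f i ∅ = 0
  f_univ : ∀ i, f i Finset.univ = 1
  w : Fin m → ℝ
  w_nonneg : ∀ i, 0 ≤ w i
  w_sum_pos : 0 < ∑ i, w i

/-- A linear ordering of the elements: a list in which each of them occurs exactly once. -/
def IsLinearOrdering {n : ℕ} (l : List (Fin n)) : Prop := l.Nodup ∧ ∀ e, e ∈ l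

namespace DSRInstance

variable {n m : ℕ} (I : DSRInstance n m)

/-- The first time at which `f i` reaches one when the elements are displayed in the order `l`
(a minimum over a nonempty set when `l` is a linear ordering of all the elements). -/
noncomputable def coverTime (l : List (Fin n)) (i : Fin m) : ℕ :=
  sInf {k : ℕ | 1 ≤ I.f i (l.take k).toFinset}

/-- The objective: the weighted sum of the cover times. -/
noncomputable def objective (l : List (Fin n)) : ℝ := ∑ i, I.w i * (I.coverTime l i : ℝ)

/-- The positive increments `f i (A ∪ {e}) - f i A`. -/
def increments : Set ℝ :=
  {d | ∃ i A e, I.f i A < I.f i (insert e A) ∧ d = I.f i (insert e A) - I.f i A}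

/-- The minimum positive increment `ε`. -/
noncomputable def epsilon : ℝ := sInf I.increments

/-- `ε` is attained: the infimum that defines it is a minimum (so `0 < ε`). -/
theorem isLeast_epsilon : IsLeast I.increments I.epsilon := by
  have hfin : I.increments.Finite := by
    have : (Set.range fun t : Fin m × Finset (Fin n) × Fin n =>
        I.f t.1 (insert t.2.2 t.2.1) - I.f t.1 t.2.1).Finite := Set.finite_range _
    refine this.subset ?_
    rintro d ⟨i, A, e, -, rfl⟩
    exact ⟨(i, A, e), rfl⟩
  have hne : I.increments.Nonempty := by
    by_contra hcon
    rw [Set.not_nonempty_iff_eq_empty] at hcon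
    have hm : ∃ i : Fin m, True := by
      by_contra h
      push Not at h
      have := I.w_sum_pos
      rw [Finset.sum_eq_zero (fun i _ => (h i).elim)] at this
      exact lt_irrefl _ this
    obtain ⟨i, -⟩ := hm
    have key : ∀ A : Finset (Fin n), I.f i A ≤ 0 := by
      intro A
      induction A using Finset.induction_on with
      | empty => exact (I.f_empty i).le
      | insert e A _ ih =>
        by_contra h
        have : I.f i (insert e A) - I.f i A ∈ I.increments :=
          ⟨i, A, e, by linarith, rfl⟩
        rw [hcon] at this
        exact this
    have := key Finset.univ
    rw [I.f_univ] at this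
    linarith
  exact ⟨hne.csInf_mem hfin, fun d hd => csInf_le hfin.bddBelow hd⟩

/-- The associated adaptive instance: unit costs, all interest sets equal to the whole ground set,
and probabilities proportional to the weights. -/
noncomputable def toASR : ASRInstance n m where
  cost _ := 1
  cost_pos _ := one_pos
  S _ := Finset.univ
  f := I.f
  f_inter i A := by rw [Finset.inter_univ]
  f_mono := I.f_mono
  f_submodular := I.f_submodular
  f_empty := I.f_empty
  f_S := I.f_univ
  p i := I.w i / ∑ j, I.w j
  p_nonneg i := div_nonneg (I.w_nonneg i) I.w_sum_pos.le
  p_sum := by rw [← Finset.sum_div, div_self I.w_sum_pos.ne']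

/-- `l` is an ordering that the greedy algorithm for adaptive ranking can return: a linear ordering
that starts with the path traced in a greedy decision tree of the associated adaptive instance (the
elements that are not displayed before all functions are covered follow in any order). -/
def IsGreedyOrdering (l : List (Fin n)) : Prop :=
  IsLinearOrdering l ∧
    ∃ T, I.toASR.IsGreedyTree ∅ Finset.univ T ∧ ∀ i, T.path (I.toASR.S i) <+: l

end DSRInstance

/-! ### An implementation with a step count

One step is charged for each value-oracle query, each arithmetic operation, comparison, membership
test, and each list cell or set entry that is written. -/

/-- A value together with the number of elementary steps spent on computing it. -/
structure Timed (α : Type) where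
  val : α
  steps : ℕ

namespace Timed

instance : Monad Timed where
  pure a := ⟨a, 0⟩
  bind x g := ⟨(g x.val).val, x.steps + (g x.val).steps⟩

/-- One elementary step with result `a`. -/
def op {α : Type} (a : α) : Timed α := ⟨a, 1⟩

/-- `k` elementary steps. -/
def tick (k : ℕ) : Timed Unit := ⟨(), k⟩

def filter {α : Type} (t : α → Timed Bool) : List α → Timed (List α)
  | [] => op []
  | a :: l => do
    let b ← t a
    let r ← filter t l
    op (if b then a :: r else r)

def length {α : Type} : List α → Timed ℕ
  | [] => op 0
  | _ :: l => do
    let k ← length l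
    op (k + 1)

noncomputable def sum {α : Type} (g : α → Timed ℝ) : List α → Timed ℝ
  | [] => op 0
  | a :: l => do
    let x ← g a
    let s ← sum g l
    op (x + s)

end Timed

namespace ASRInstance

open Timed

variable {n m : ℕ} (A : ASRInstance n m)

/-- Computes the set `L_e(H)`. -/
def lightT (H : List (Fin m)) (e : Fin n) : Timed (List (Fin m)) := do
  let Y ← Timed.filter (fun i => op (decide (e ∈ A.S i))) H
  let N ← Timed.filter (fun i => op (decide (e ∉ A.S i))) H
  let y ← Timed.length Y
  let k ← Timed.length N
  let b ← op (decide (y ≤ k))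
  if b then pure Y else pure N

/-- Computes the greedy score of `e` at the state `(E, H)`. -/
noncomputable def scoreT (E : Finset (Fin n)) (H : List (Fin m)) (e : Fin n) : Timed ℝ := do
  let E' ← op (insert e E)
  let L ← A.lightT H e
  let a ← Timed.sum (fun j => op (A.p j)) L
  let b ← Timed.sum (fun i => do
    let x ← op (A.f i E')
    let y ← op (A.f i E)
    let d ← op (x - y)
    let r ← op (1 - y)
    let q ← op (d / r)
    op (A.p i * q)) H
  let s ← op (a + b)
  let c ← op (1 / A.cost e)
  op (c * s)

/-- Finds an element of maximum score in a list of candidates, together with its score. -/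
noncomputable def bestT (E : Finset (Fin n)) (H : List (Fin m)) :
    List (Fin n) → Timed (Option (Fin n × ℝ))
  | [] => op none
  | e :: l => do
    let s ← A.scoreT E H e
    let r ← bestT E H l
    match r with
    | none => op (some (e, s))
    | some (e', s') => do
      let b ← op (decide (s' ≤ s))
      op (if b then some (e, s) else some (e', s'))

/-- Runs the greedy algorithm from the state `(E, H)` for at most `k` elements, where `feedback e`
tells whether `e` is relevant to the realized scenario; returns the displayed elements. -/
noncomputable def runT (feedback : Fin n → Bool) :
    ℕ → Finset (Fin n) → List (Fin m) → Timed (List (Fin n))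
  | 0, _, _ => op []
  | k + 1, E, H => do
    let done ← op H.isEmpty
    if done then op [] else do
      let R ← Timed.filter (fun e => op (decide (e ∉ E))) (List.finRange n)
      let best ← A.bestT E H R
      match best with
      | none => op []
      | some (e, _) => do
        let b ← op (feedback e)
        let E' ← op (insert e E)
        let H₁ ← Timed.filter (fun i => op (decide (e ∈ A.S i) == b)) H
        let H₂ ← Timed.filter (fun i => do
          let v ← op (A.f i E')
          op (decide (v < 1))) H₁
        let l ← runT feedback k E' H₂
        op (e :: l)

end ASRInstance

/-- The algorithm for deterministic submodular ranking: it sets up the associated adaptive instance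
(unit costs, full interest sets, the sum of the weights, the `m` quotients, the list of scenarios),
runs the greedy algorithm, where all feedback is positive, and appends the remaining elements. -/
noncomputable def DSRInstance.algorithm {n m : ℕ} (I : DSRInstance n m) :
    Timed (List (Fin n)) := do
  Timed.tick (n + n * m + m + m + m)
  let l ← I.toASR.runT (fun _ => true) n ∅ (List.finRange m)
  let r ← Timed.filter (fun e => do
    Timed.tick l.length
    Timed.op (decide (e ∉ l))) (List.finRange n)
  Timed.tick l.length
  Timed.op (l ++ r)

/-! ### Analysis of the greedy ordering -/

namespace DSRInstance

variable {n m : ℕ} (I : DSRInstance n m)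

/-! With full interest sets no scenario ever answers "no", so `light` vanishes and a greedy tree is
in effect a single path. The score becomes, up to the total weight, `gain`: the weighted sum of the
relative increments of the uncovered functions.

Let r(t) and q(j) be the weights left uncovered by the first t elements of the greedy list and the
first j elements of its competitor. Each objective is the sum of these weights over time
(`objective_eq_sum`). Let k(t) be the least j with 2 q(j) ≤ r(t). By submodularity, the first k(t)
competitor elements have total gain at least r(t) - q(k(t)) ≥ r(t)/2 at the greedy state, so r(t) is
at most 2 k(t) times the greedy gain (`uncoveredWeight_sub_le`).

Sum over t and exchange sums. Since k is monotone, function i is charged at most 2 w_i k(c_i - 1),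
with c_i its greedy cover time, times its total relative increment. That total is at most α = 1 +
ln(1/ε), by a telescoping logarithm (`sum_relGain_le`). Finally the sum of w_i k(c_i - 1) is counted
by levels: j < k(c_i - 1) forces r(c_i - 1) < 2 q(j), and such i have total weight at most 2 q(j).
This gives the factor 4α (`objective_le_of_greedy`).

The implementation is handled separately: its run is shown to trace a greedy tree
(`exists_isGreedyTree_runT`), and its steps are bounded by adding up the costs of each round
(`steps_runT_le`). -/

theorem light_toASR (e : Fin n) (H : Finset (Fin m)) : I.toASR.light e H = ∅ := by
  have h1 : (H.filter fun i => e ∉ I.toASR.S i) = ∅ := by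
    simp [toASR]
  unfold ASRInstance.light
  split_ifs with h
  -- Ties in `light` go to the yes-side, which here has cardinality at most zero.
  · rw [h1, Finset.card_empty, Nat.le_zero, Finset.card_eq_zero] at h
    exact h
  · exact h1

theorem f_le_one (i : Fin m) (A : Finset (Fin n)) : I.f i A ≤ 1 :=
  (I.f_mono i A _ (Finset.subset_univ A)).trans (I.f_univ i).le

theorem f_nonneg (i : Fin m) (A : Finset (Fin n)) : 0 ≤ I.f i A :=
  (I.f_empty i).ge.trans (I.f_mono i _ A (Finset.empty_subset A))

theorem epsilon_pos : 0 < I.epsilon := by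
  obtain ⟨i, A, e, h, hd⟩ := I.isLeast_epsilon.1
  linarith

/-- A monotone submodular function gains at most the sum of the single increments. -/
theorem f_union_sub_le (i : Fin m) (E O : Finset (Fin n)) :
    I.f i (E ∪ O) - I.f i E ≤ ∑ e ∈ O, (I.f i (insert e E) - I.f i E) := by
  induction O using Finset.induction_on with
  | empty => simp
  | insert a O ha ih =>
    rw [Finset.sum_insert ha]
    -- The two sets meet in a superset of `E`, so adding `a` to `E ∪ O` gains no more than adding it
    -- to `E`.
    have hs := I.f_submodular i (insert a E) (E ∪ O)
    have h1 : I.f i E ≤ I.f i (insert a E ∩ (E ∪ O)) :=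
      I.f_mono i _ _ (Finset.subset_inter (Finset.subset_insert a E) Finset.subset_union_left)
    have h2 : insert a E ∪ (E ∪ O) = E ∪ insert a O := by
      ext x
      simp only [Finset.mem_union, Finset.mem_insert]
      tauto
    rw [h2] at hs
    linarith

/-- An uncovered function is at distance at least `ε` from one. -/
theorem epsilon_le_one_sub (i : Fin m) (E : Finset (Fin n)) (h : I.f i E < 1) :
    I.epsilon ≤ 1 - I.f i E := by
  by_contra hlt
  push Not at hlt
  have h1 := I.f_union_sub_le i E Finset.univ
  rw [Finset.union_eq_right.2 (Finset.subset_univ E), I.f_univ] at h1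
  -- The increments at `E` sum to at least `1 - f i E > 0`, so one of them is positive, hence at
  -- least ε; it cannot lift `f i` above one.
  obtain ⟨e, -, he⟩ := Finset.exists_lt_of_sum_lt
    (s := Finset.univ) (f := fun _ : Fin n => (0 : ℝ))
    (g := fun e => I.f i (insert e E) - I.f i E) (by rw [Finset.sum_const_zero]; linarith)
  have h2 := I.isLeast_epsilon.2 ⟨i, E, e, by linarith, rfl⟩
  have h3 := I.f_le_one i (insert e E)
  linarith

theorem epsilon_le_one : I.epsilon ≤ 1 := by
  obtain ⟨i, A, e, -, hd⟩ := I.isLeast_epsilon.1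
  have h3 := I.f_le_one i (insert e A)
  have h4 := I.f_nonneg i A
  linarith

/-- The functions that are not covered by `E`. -/
noncomputable def uncovered (E : Finset (Fin n)) : Finset (Fin m) :=
  Finset.univ.filter fun i => I.f i E < 1

theorem mem_uncovered {E : Finset (Fin n)} {i : Fin m} :
    i ∈ I.uncovered E ↔ I.f i E < 1 := by
  simp [uncovered]

theorem uncovered_anti {E F : Finset (Fin n)} (h : E ⊆ F) : I.uncovered F ⊆ I.uncovered E := by
  intro i hi
  rw [mem_uncovered] at hi ⊢
  exact (I.f_mono i _ _ h).trans_lt hi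

/-- The total weight of the functions that are not covered by `E`. -/
noncomputable def uncoveredWeight (E : Finset (Fin n)) : ℝ := ∑ i ∈ I.uncovered E, I.w i

theorem uncoveredWeight_anti {E F : Finset (Fin n)} (h : E ⊆ F) :
    I.uncoveredWeight F ≤ I.uncoveredWeight E :=
  Finset.sum_le_sum_of_subset_of_nonneg (I.uncovered_anti h) fun i _ _ => I.w_nonneg i

theorem uncoveredWeight_nonneg (E : Finset (Fin n)) : 0 ≤ I.uncoveredWeight E :=
  Finset.sum_nonneg fun i _ => I.w_nonneg i

/-- The relative increment of `f i` when `e` is added to `E`. -/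
noncomputable def relGain (i : Fin m) (E : Finset (Fin n)) (e : Fin n) : ℝ :=
  (I.f i (insert e E) - I.f i E) / (1 - I.f i E)

theorem relGain_nonneg (i : Fin m) (E : Finset (Fin n)) (e : Fin n) : 0 ≤ I.relGain i E e :=
  div_nonneg (sub_nonneg.2 (I.f_mono i _ _ (Finset.subset_insert e E)))
    (sub_nonneg.2 (I.f_le_one i E))

/-- The weighted sum of the relative increments of the uncovered functions. -/
noncomputable def gain (E : Finset (Fin n)) (e : Fin n) : ℝ :=
  ∑ i ∈ I.uncovered E, I.w i * I.relGain i E e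

theorem gain_nonneg (E : Finset (Fin n)) (e : Fin n) : 0 ≤ I.gain E e :=
  Finset.sum_nonneg fun i _ => mul_nonneg (I.w_nonneg i) (I.relGain_nonneg i E e)

theorem score_toASR (E : Finset (Fin n)) (H : Finset (Fin m)) (e : Fin n) :
    I.toASR.score E H e = (∑ i ∈ H, I.w i * I.relGain i E e) / ∑ j, I.w j := by
  unfold ASRInstance.score
  rw [light_toASR, Finset.sum_empty, zero_add, Finset.sum_div]
  simp only [toASR, relGain, div_one, one_mul]
  exact Finset.sum_congr rfl fun i _ => by ring

/-- If `e` has the largest gain at `E`, then its gain is at least a `1 / |O|` fraction of the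
weight that the set `O` covers in addition. -/
theorem uncoveredWeight_sub_le (E O : Finset (Fin n)) (e : Fin n)
    (hmax : ∀ e', e' ∉ E → I.gain E e' ≤ I.gain E e) :
    I.uncoveredWeight E - I.uncoveredWeight O ≤ O.card * I.gain E e := by
  -- Elements of `O` may already lie in `E`; their gain is zero.
  have hle : ∀ e', I.gain E e' ≤ I.gain E e := by
    intro e'
    by_cases he : e' ∈ E
    · refine le_trans (le_of_eq ?_) (I.gain_nonneg E e)
      refine Finset.sum_eq_zero fun i _ => ?_
      simp [relGain, Finset.insert_eq_of_mem he]
    · exact hmax e' he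
  have h1 : ∑ e' ∈ O, I.gain E e' ≤ O.card * I.gain E e := by
    simpa using Finset.sum_le_card_nsmul O _ _ fun e' _ => hle e'
  refine le_trans ?_ h1
  unfold gain
  rw [Finset.sum_comm, sub_le_iff_le_add]
  have h2 : I.uncoveredWeight E ≤
      ∑ i ∈ I.uncovered E \ I.uncovered O, I.w i + I.uncoveredWeight O := by
    unfold uncoveredWeight
    rw [← Finset.sum_sdiff (Finset.inter_subset_left : I.uncovered E ∩ I.uncovered O ⊆ _),
      Finset.sdiff_inter_self_left]
    exact add_le_add le_rfl (Finset.sum_le_sum_of_subset_of_nonneg Finset.inter_subset_right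
      fun i _ _ => I.w_nonneg i)
  refine h2.trans (add_le_add ?_ le_rfl)
  refine le_trans (Finset.sum_le_sum fun i hi => ?_)
    (Finset.sum_le_sum_of_subset_of_nonneg Finset.sdiff_subset fun i _ _ =>
      Finset.sum_nonneg fun e _ => mul_nonneg (I.w_nonneg i) (I.relGain_nonneg i E e))
  -- A function covered by `O` but not by `E` has relative increments over `O` that sum to at least
  -- one.
  rw [Finset.mem_sdiff, mem_uncovered, mem_uncovered, not_lt] at hi
  rw [← Finset.mul_sum]
  refine le_mul_of_one_le_right (I.w_nonneg i) ?_
  unfold relGain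
  rw [← Finset.sum_div, one_le_div (by linarith [hi.1])]
  have h3 := I.f_union_sub_le i E O
  have h4 := I.f_mono i O (E ∪ O) Finset.subset_union_right
  linarith [hi.2]

/-! ### Cover times -/

/-- The set of the first `t` elements of `l`. -/
def initial (l : List (Fin n)) (t : ℕ) : Finset (Fin n) := (l.take t).toFinset

theorem initial_mono (l : List (Fin n)) {s t : ℕ} (h : s ≤ t) : initial l s ⊆ initial l t := by
  intro x hx
  simp only [initial, List.mem_toFinset] at hx ⊢
  exact (List.take_subset_take_left l h) hx

theorem card_initial_le (l : List (Fin n)) (t : ℕ) : (initial l t).card ≤ t :=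
  (List.toFinset_card_le _).trans (by simp)

theorem initial_succ (l : List (Fin n)) {t : ℕ} (h : t < l.length) :
    initial l (t + 1) = insert l[t] (initial l t) := by
  ext x
  simp only [initial, List.mem_toFinset, Finset.mem_insert, List.take_add_one,
    List.getElem?_eq_getElem h, Option.toList_some, List.mem_append, List.mem_singleton]
  tauto

/-- The hypothesis `hL` makes the set of covering times nonempty; otherwise its infimum would take
the default value 0 and the left side would hold for every `t`. -/
theorem coverTime_le_iff (l : List (Fin n)) (i : Fin m) {L : ℕ}
    (hL : 1 ≤ I.f i (initial l L)) (t : ℕ) :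
    I.coverTime l i ≤ t ↔ 1 ≤ I.f i (initial l t) := by
  constructor
  · intro h
    have h1 : 1 ≤ I.f i (initial l (I.coverTime l i)) := 
      Nat.sInf_mem (s := {k : ℕ | 1 ≤ I.f i (l.take k).toFinset}) ⟨L, hL⟩
    exact h1.trans (I.f_mono i _ _ (initial_mono l h))
  · intro h
    exact Nat.sInf_le h

theorem lt_coverTime_iff (l : List (Fin n)) (i : Fin m) {L : ℕ}
    (hL : 1 ≤ I.f i (initial l L)) (t : ℕ) :
    t < I.coverTime l i ↔ i ∈ I.uncovered (initial l t) := by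
  rw [mem_uncovered, ← not_le, ← not_le, coverTime_le_iff I l i hL]

/-- A natural number is the number of its predecessors, counted up to any upper bound. -/
theorem sum_range_ite_lt {a L : ℕ} (h : a ≤ L) :
    ∑ t ∈ Finset.range L, (if t < a then (1 : ℝ) else 0) = a := by
  rw [← Finset.sum_filter, Finset.sum_const, nsmul_eq_mul, mul_one]
  congr 1
  have : (Finset.range L).filter (· < a) = Finset.range a := by
    ext t
    simp only [Finset.mem_filter, Finset.mem_range]
    omega
  rw [this, Finset.card_range]

/-- The objective is the sum over time of the uncovered weight. -/
theorem objective_eq_sum (l : List (Fin n)) {L : ℕ} (hL : ∀ i, 1 ≤ I.f i (initial l L)) :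
    I.objective l = ∑ t ∈ Finset.range L, I.uncoveredWeight (initial l t) := by
  unfold objective uncoveredWeight
  have h1 : ∀ t, ∑ i ∈ I.uncovered (initial l t), I.w i
      = ∑ i, if t < I.coverTime l i then I.w i else 0 := by
    intro t
    rw [← Finset.sum_filter]
    congr 1
    ext i
    simp [lt_coverTime_iff I l i (hL i)]
  simp_rw [h1]
  rw [Finset.sum_comm]
  refine Finset.sum_congr rfl fun i _ => ?_
  rw [← sum_range_ite_lt ((coverTime_le_iff I l i (hL i) L).2 (hL i)), Finset.mul_sum]
  simp

theorem IsLinearOrdering.length_eq {l : List (Fin n)} (h : IsLinearOrdering l) :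
    l.length = n := by
  have h1 : l.toFinset = Finset.univ := by
    ext x
    simp [h.2 x]
  rw [← List.toFinset_card_of_nodup h.1, h1, Finset.card_univ, Fintype.card_fin]

theorem f_initial_of_isLinearOrdering {l : List (Fin n)} (h : IsLinearOrdering l) (i : Fin m) :
    1 ≤ I.f i (initial l n) := by
  have h1 : initial l n = Finset.univ := by
    ext x
    simp [initial, List.take_of_length_le (IsLinearOrdering.length_eq h).le, h.2 x]
  rw [h1, I.f_univ]

/-! ### The logarithmic bound -/

/-- Removes `l[t]`, so that later sums over time need no bound on `t`. -/
theorem relGain_eq (l : List (Fin n)) (i : Fin m) {t : ℕ} (ht : t < l.length) :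
    I.relGain i (initial l t) l[t] =
      (I.f i (initial l (t + 1)) - I.f i (initial l t)) / (1 - I.f i (initial l t)) := by
  rw [relGain, initial_succ l ht]

/-- With x and y the distances to one before and after a step, the relative increment is 1 - y/x ≤
ln x - ln y, and these differences telescope from ln 1 = 0. -/
theorem sum_relGain_le_log (l : List (Fin n)) (i : Fin m) (g : ℕ → ℝ)
    (hg : ∀ t, g t = (I.f i (initial l (t + 1)) - I.f i (initial l t)) /
      (1 - I.f i (initial l t))) (s : ℕ) (hs : I.f i (initial l s) < 1) :
    ∑ t ∈ Finset.range s, g t ≤ -Real.log (1 - I.f i (initial l s)) := by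
  induction s with
  | zero => simp [initial, I.f_empty]
  | succ s ih =>
    have hle := I.f_mono i _ _ (initial_mono l (Nat.le_succ s))
    have hs' : I.f i (initial l s) < 1 := hle.trans_lt hs
    rw [Finset.sum_range_succ, hg s]
    have h1 := ih hs'
    have hx : 0 < 1 - I.f i (initial l s) := by linarith
    have hy : 0 < 1 - I.f i (initial l (s + 1)) := by linarith
    have h2 := Real.log_le_sub_one_of_pos (div_pos hy hx)
    rw [Real.log_div hy.ne' hx.ne'] at h2
    have h3 : (I.f i (initial l (s + 1)) - I.f i (initial l s)) / (1 - I.f i (initial l s))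
        = 1 - (1 - I.f i (initial l (s + 1))) / (1 - I.f i (initial l s)) := by
      field_simp
      ring
    linarith

/-- Until a function is covered, its relative increments sum up to at most `1 + ln (1 / ε)`. -/
theorem sum_relGain_le (l : List (Fin n)) (i : Fin m) (g : ℕ → ℝ)
    (hg : ∀ t, g t = (I.f i (initial l (t + 1)) - I.f i (initial l t)) /
      (1 - I.f i (initial l t))) {L : ℕ} (hL : 1 ≤ I.f i (initial l L)) :
    ∑ t ∈ Finset.range (I.coverTime l i), g t ≤ 1 + Real.log (1 / I.epsilon) := by
  rw [one_div, Real.log_inv]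
  rcases hc : I.coverTime l i with _ | s
  · have := Real.log_nonpos I.epsilon_pos.le I.epsilon_le_one
    rw [Finset.range_zero, Finset.sum_empty]
    linarith
  · have hs : I.f i (initial l s) < 1 := by
      rw [← I.mem_uncovered, ← I.lt_coverTime_iff l i hL]
      omega
    have h1 := I.sum_relGain_le_log l i g hg s hs
    -- The covering step lies outside the logarithmic bound, since the distance drops to zero there;
    -- it accounts for the summand 1.
    have h2 : g s ≤ 1 := by
      rw [hg]
      exact div_le_one_of_le₀ (by linarith [I.f_le_one i (initial l (s + 1))])
        (by linarith)
    have h3 := Real.log_le_log I.epsilon_pos (I.epsilon_le_one_sub i _ hs)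
    rw [Finset.sum_range_succ]
    linarith

/-! ### Comparison of a greedy list with another ordering -/

/-- If every element of `l` up to the position `L`, where all functions are covered, has the
largest gain, then the objective of `l` is within the stated factor of any other. -/
theorem objective_le_of_greedy (l l' : List (Fin n)) (L : ℕ) (hlen : L ≤ l.length)
    (hL : ∀ i, 1 ≤ I.f i (initial l L))
    (hmax : ∀ t (ht : t < L), ∀ e, e ∉ initial l t →
      I.gain (initial l t) e ≤ I.gain (initial l t) (l[t]'(ht.trans_le hlen)))
    (L' : ℕ) (hL' : ∀ i, 1 ≤ I.f i (initial l' L')) :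
    I.objective l ≤ 4 * (1 + Real.log (1 / I.epsilon)) * I.objective l' := by
  set α := 1 + Real.log (1 / I.epsilon) with hα
  have hα0 : 0 ≤ α := by
    have := Real.log_nonpos I.epsilon_pos.le I.epsilon_le_one
    rw [hα, one_div, Real.log_inv]
    linarith
  let r : ℕ → ℝ := fun t => I.uncoveredWeight (initial l t)
  let q : ℕ → ℝ := fun t => I.uncoveredWeight (initial l' t)
  have r_anti : Antitone r := fun s t h => I.uncoveredWeight_anti (initial_mono l h)
  have q_anti : Antitone q := fun s t h => I.uncoveredWeight_anti (initial_mono l' h)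
  have hqL : q L' = 0 := by
    refine Finset.sum_eq_zero fun i hi => ?_
    rw [mem_uncovered] at hi
    exact absurd hi (not_lt.2 (hL' i))
  have hex : ∀ t, ∃ k, 2 * q k ≤ r t := fun t =>
    ⟨L', by rw [hqL, mul_zero]; exact I.uncoveredWeight_nonneg _⟩
  classical
  -- The competitor's time needed to leave at most half of the weight that greedy leaves at time
  -- `t`.
  let k : ℕ → ℕ := fun t => Nat.find (hex t)
  have hk : ∀ t, 2 * q (k t) ≤ r t := fun t => Nat.find_spec (hex t)
  have hkL : ∀ t, k t ≤ L' := fun t => Nat.find_min' (hex t) (by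
    rw [hqL, mul_zero]; exact I.uncoveredWeight_nonneg _)
  have hk_lt : ∀ t j, j < k t → r t < 2 * q j := fun t j hj => by
    have := Nat.find_min (hex t) hj
    exact not_le.1 this
  have k_mono : Monotone k := fun s t h =>
    Nat.find_min' (hex s) ((hk t).trans (r_anti h))
  let g : Fin m → ℕ → ℝ := fun i t =>
    (I.f i (initial l (t + 1)) - I.f i (initial l t)) / (1 - I.f i (initial l t))
  have hg0 : ∀ i t, 0 ≤ g i t := fun i t =>
    div_nonneg (sub_nonneg.2 (I.f_mono i _ _ (initial_mono l (Nat.le_succ t))))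
      (sub_nonneg.2 (I.f_le_one i _))
  have hstep : ∀ t ∈ Finset.range L, r t ≤
      ∑ i, if t < I.coverTime l i then 2 * (I.w i * (g i t * k t)) else 0 := by
    intro t ht
    have ht' := Finset.mem_range.1 ht
    -- Greedy is compared with the average of the first `k t` elements of `l'`; by `hk`, the left
    -- side is at least half of `r t`.
    have h1 := I.uncoveredWeight_sub_le (initial l t) (initial l' (k t)) _ (hmax t ht')
    have h2 : ((initial l' (k t)).card : ℝ) ≤ k t := by exact_mod_cast card_initial_le l' (k t)
    have h3 := mul_le_mul_of_nonneg_right h2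
      (I.gain_nonneg (initial l t) (l[t]'(ht'.trans_le hlen)))
    have h4 : r t - q (k t) ≤ k t * I.gain (initial l t) (l[t]'(ht'.trans_le hlen)) := h1.trans h3
    have h5 := hk t
    have h6 : ∑ i, (if t < I.coverTime l i then 2 * (I.w i * (g i t * k t)) else 0)
        = 2 * (k t * I.gain (initial l t) (l[t]'(ht'.trans_le hlen))) := by
      rw [← Finset.sum_filter, gain, Finset.mul_sum, Finset.mul_sum]
      refine Finset.sum_congr ?_ fun i _ => ?_
      · ext i
        simp [lt_coverTime_iff I l i (hL i)]
      · rw [relGain_eq I l i (ht'.trans_le hlen)]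
        ring
    rw [h6]
    linarith
  have hsum : ∀ i, ∑ t ∈ Finset.range (I.coverTime l i), g i t * k t
      ≤ α * k (I.coverTime l i - 1) := by
    intro i
    calc ∑ t ∈ Finset.range (I.coverTime l i), g i t * k t
        ≤ ∑ t ∈ Finset.range (I.coverTime l i), g i t * k (I.coverTime l i - 1) := by
          refine Finset.sum_le_sum fun t ht => ?_
          refine mul_le_mul_of_nonneg_left ?_ (hg0 i t)
          have := Finset.mem_range.1 ht
          exact_mod_cast k_mono (by omega)
      _ = (∑ t ∈ Finset.range (I.coverTime l i), g i t) * k (I.coverTime l i - 1) := by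
          rw [Finset.sum_mul]
      _ ≤ α * k (I.coverTime l i - 1) :=
          mul_le_mul_of_nonneg_right (I.sum_relGain_le l i (g i) (fun _ => rfl) (hL i))
            (Nat.cast_nonneg _)
  have hlevel : ∀ x : ℝ, 0 ≤ x →
      ∑ i ∈ Finset.univ.filter (fun i => r (I.coverTime l i - 1) < x), I.w i ≤ x := by
    intro x hx
    rcases Finset.eq_empty_or_nonempty
      (Finset.univ.filter (fun i => r (I.coverTime l i - 1) < x)) with h | h
    · rw [h, Finset.sum_empty]
      exact hx
    -- Just before `i₀`, the earliest covered member, is covered, all members are still uncovered,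
    -- so their weight is at most `r` at that time.
    · obtain ⟨i₀, hi₀, hmin⟩ := Finset.exists_min_image _ (fun i => I.coverTime l i) h
      refine le_trans ?_ (Finset.mem_filter.1 hi₀).2.le
      refine Finset.sum_le_sum_of_subset_of_nonneg (fun i hi => ?_) fun i _ _ => I.w_nonneg i
      rw [← lt_coverTime_iff I l i (hL i)]
      have h1 := hmin i hi
      -- Nothing is covered at time 0, so the subtraction of one is not truncated.
      have h2 : 0 < I.coverTime l i := by
        rw [lt_coverTime_iff I l i (hL i), mem_uncovered]
        simp [initial, I.f_empty]
      omega
  calc I.objective l = ∑ t ∈ Finset.range L, r t := I.objective_eq_sum l hL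
    _ ≤ ∑ t ∈ Finset.range L,
          ∑ i, if t < I.coverTime l i then 2 * (I.w i * (g i t * k t)) else 0 :=
        Finset.sum_le_sum hstep
    _ = ∑ i, 2 * (I.w i * ∑ t ∈ Finset.range (I.coverTime l i), g i t * k t) := by
        rw [Finset.sum_comm]
        refine Finset.sum_congr rfl fun i _ => ?_
        have hc := (coverTime_le_iff I l i (hL i) L).2 (hL i)
        rw [← Finset.sum_filter, Finset.mul_sum, Finset.mul_sum]
        refine Finset.sum_congr ?_ fun _ _ => rfl
        ext t
        simp only [Finset.mem_filter, Finset.mem_range]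
        omega
    _ ≤ ∑ i, 2 * (I.w i * (α * k (I.coverTime l i - 1))) := by
        refine Finset.sum_le_sum fun i _ => ?_
        exact mul_le_mul_of_nonneg_left
          (mul_le_mul_of_nonneg_left (hsum i) (I.w_nonneg i)) zero_le_two
    -- Each `k` is written as the number of `j` below it, in preparation for summing over levels
    -- `j`.
    _ = 2 * α * ∑ i, ∑ j ∈ Finset.range L',
          (if j < k (I.coverTime l i - 1) then I.w i else 0) := by
        rw [Finset.mul_sum]
        refine Finset.sum_congr rfl fun i _ => ?_
        have h1 := sum_range_ite_lt (hkL (I.coverTime l i - 1))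
        rw [← h1, Finset.mul_sum, Finset.mul_sum, Finset.mul_sum, Finset.mul_sum]
        refine Finset.sum_congr rfl fun j _ => ?_
        split_ifs <;> ring
    _ ≤ 2 * α * ∑ j ∈ Finset.range L', 2 * q j := by
        rw [Finset.sum_comm]
        refine mul_le_mul_of_nonneg_left (Finset.sum_le_sum fun j _ => ?_) (by positivity)
        refine le_trans ?_ (hlevel (2 * q j)
          (mul_nonneg zero_le_two (I.uncoveredWeight_nonneg _)))
        rw [← Finset.sum_filter]
        refine Finset.sum_le_sum_of_subset_of_nonneg (fun i hi => ?_) fun i _ _ => I.w_nonneg i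
        rw [Finset.mem_filter] at hi ⊢
        exact ⟨hi.1, hk_lt _ _ hi.2⟩
    _ = 4 * α * I.objective l' := by
        rw [I.objective_eq_sum l' hL', ← Finset.mul_sum]
        ring

/-! ### From greedy trees to greedy lists -/

theorem gain_le_gain_of_score_le {E : Finset (Fin n)} {e e' : Fin n}
    (h : I.toASR.score E (I.uncovered E) e' ≤ I.toASR.score E (I.uncovered E) e) :
    I.gain E e' ≤ I.gain E e := by
  rw [score_toASR, score_toASR, div_le_div_iff_of_pos_right I.w_sum_pos] at h
  exact h

/-- Along yes-branches the alive scenarios remain exactly the uncovered functions; this is the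
invariant behind `greedy_path`. -/
theorem uncovered_insert (E : Finset (Fin n)) (e : Fin n) :
    ((I.uncovered E).filter fun i => e ∈ I.toASR.S i ∧ I.toASR.f i (insert e E) < 1)
      = I.uncovered (insert e E) := by
  ext i
  simp only [Finset.mem_filter, mem_uncovered, toASR, Finset.mem_univ, true_and]
  exact ⟨fun h => h.2,
    fun h => ⟨(I.f_mono i _ _ (Finset.subset_insert e E)).trans_lt h, h⟩⟩

/-- Along the path of a greedy tree every element has the largest gain, and the path ends only
when all functions are covered. -/
theorem greedy_path {E : Finset (Fin n)} {H : Finset (Fin m)} {T : DecisionTree n}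
    (hT : I.toASR.IsGreedyTree E H T) (hH : H = I.uncovered E) :
    (∀ i, 1 ≤ I.f i (E ∪ (T.path Finset.univ).toFinset)) ∧
    ∀ t (ht : t < (T.path Finset.univ).length),
      ∀ e, e ∉ E ∪ initial (T.path Finset.univ) t →
        I.gain (E ∪ initial (T.path Finset.univ) t) e ≤
          I.gain (E ∪ initial (T.path Finset.univ) t) (T.path Finset.univ)[t] := by
  induction hT with
  | leaf E =>
    refine ⟨fun i => ?_, fun t ht => absurd ht (by simp [DecisionTree.path])⟩
    have h1 : i ∉ I.uncovered E := by simp [← hH]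
    rw [mem_uncovered, not_lt] at h1
    simpa [DecisionTree.path] using h1
  | node E H e yes no hne he hmax hyes hno ihyes _ =>
    subst hH
    obtain ⟨h1, h2⟩ := ihyes (I.uncovered_insert E e)
    have hp : (DecisionTree.node e yes no).path Finset.univ = e :: yes.path Finset.univ := by
      simp [DecisionTree.path]
    rw [hp]
    have hu : ∀ F : Finset (Fin n), E ∪ insert e F = insert e E ∪ F := by
      intro F
      ext x
      simp only [Finset.mem_union, Finset.mem_insert]
      tauto
    refine ⟨fun i => ?_, fun t ht => ?_⟩
    · rw [List.toFinset_cons, hu]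
      exact h1 i
    · rcases t with _ | t
      · simp only [initial, List.take_zero, List.toFinset_nil, Finset.union_empty,
          List.getElem_cons_zero]
        exact fun e' he' => I.gain_le_gain_of_score_le (hmax e' he')
      · have ht' : t < (yes.path Finset.univ).length := by simpa using ht
        have h3 : initial (e :: yes.path Finset.univ) (t + 1)
            = insert e (initial (yes.path Finset.univ) t) := by
          simp [initial]
        rw [h3, hu]
        simpa using h2 t ht'

theorem IsGreedyOrdering.objective_le {l l' : List (Fin n)} (hl : I.IsGreedyOrdering l)
    (hl' : IsLinearOrdering l') :
    I.objective l ≤ 4 * (1 + Real.log (1 / I.epsilon)) * I.objective l' := by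
  obtain ⟨-, T, hT, hpre⟩ := hl
  -- The prefix condition is quantified over scenarios, so one scenario is needed to use it.
  have hm : Nonempty (Fin m) := by
    by_contra h
    rw [not_nonempty_iff] at h
    have := I.w_sum_pos
    simp at this
  obtain ⟨s, hs⟩ : T.path Finset.univ <+: l := hpre hm.some
  obtain ⟨h1, h2⟩ := I.greedy_path hT (by
    ext i
    simp [mem_uncovered, I.f_empty])
  simp only [Finset.empty_union] at h1 h2
  have hlen : (T.path Finset.univ).length ≤ l.length := by rw [← hs]; simp
  have hin : ∀ t ≤ (T.path Finset.univ).length,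
      initial l t = initial (T.path Finset.univ) t := by
    intro t ht
    rw [initial, initial, ← hs, List.take_append_of_le_length ht]
  refine I.objective_le_of_greedy l l' (T.path Finset.univ).length hlen (fun i => ?_)
    (fun t ht => ?_) n (I.f_initial_of_isLinearOrdering hl')
  · rw [hin _ le_rfl]
    simpa [initial] using h1 i
  · rw [hin t ht.le]
    have h3 : l[t]'(ht.trans_le hlen) = (T.path Finset.univ)[t] := by
      subst hs
      rw [List.getElem_append_left ht]
    rw [h3]
    exact h2 t ht

end DSRInstance

/-! ### The implementation -/

namespace Timed

variable {α β : Type}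

theorem val_pure (a : α) : (pure a : Timed α).val = a := rfl

theorem steps_pure (a : α) : (pure a : Timed α).steps = 0 := rfl

theorem val_bind (x : Timed α) (g : α → Timed β) : (x >>= g).val = (g x.val).val := rfl

theorem steps_bind (x : Timed α) (g : α → Timed β) :
    (x >>= g).steps = x.steps + (g x.val).steps := rfl

theorem val_op (a : α) : (op a).val = a := rfl

theorem steps_op (a : α) : (op a).steps = 1 := rfl

theorem op_decide_bind_ite (p : Prop) [Decidable p] (x y : Timed α) :
    (op (decide p) >>= fun b => if b then x else y) =
      ⟨if p then x.val else y.val, 1 + if p then x.steps else y.steps⟩ := by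
  by_cases h : p
  · rw [decide_eq_true h, if_pos h, if_pos h]
    rfl
  · rw [decide_eq_false h, if_neg h, if_neg h]
    rfl

theorem val_filter (t : α → Timed Bool) (l : List α) :
    (Timed.filter t l).val = l.filter fun a => (t a).val := by
  induction l with
  | nil => rfl
  | cons a l ih =>
    simp only [Timed.filter, val_bind, val_op, ih, List.filter_cons]

theorem steps_filter_le (t : α → Timed Bool) (c : ℕ) (l : List α) (h : ∀ a, (t a).steps ≤ c) :
    (Timed.filter t l).steps ≤ (c + 1) * l.length + 1 := by
  induction l with
  | nil => simp [Timed.filter, steps_op]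
  | cons a l ih =>
    simp only [Timed.filter, steps_bind, steps_op, List.length_cons]
    have := h a
    linarith

theorem val_length (l : List α) : (Timed.length l).val = l.length := by
  induction l with
  | nil => rfl
  | cons a l ih => simp only [Timed.length, val_bind, val_op, ih, List.length_cons]

theorem steps_length (l : List α) : (Timed.length l).steps = l.length + 1 := by
  induction l with
  | nil => rfl
  | cons a l ih => simp only [Timed.length, steps_bind, steps_op, ih, List.length_cons]

theorem val_sum (g : α → Timed ℝ) (l : List α) :
    (Timed.sum g l).val = (l.map fun a => (g a).val).sum := by
  induction l with
  | nil => rfl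
  | cons a l ih => simp only [Timed.sum, val_bind, val_op, ih, List.map_cons, List.sum_cons]

theorem steps_sum_le (g : α → Timed ℝ) (c : ℕ) (l : List α) (h : ∀ a, (g a).steps ≤ c) :
    (Timed.sum g l).steps ≤ (c + 1) * l.length + 1 := by
  induction l with
  | nil => simp [Timed.sum, steps_op]
  | cons a l ih =>
    simp only [Timed.sum, steps_bind, steps_op, List.length_cons]
    have := h a
    linarith

end Timed

/-! ### Correctness and step count of the adaptive greedy run -/

namespace ASRInstance

open Timed

variable {n m : ℕ} (A : ASRInstance n m)

theorem val_lightT (H : List (Fin m)) (e : Fin n) :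
    (A.lightT H e).val =
      if (H.filter fun i => e ∈ A.S i).length ≤ (H.filter fun i => e ∉ A.S i).length then
        H.filter fun i => e ∈ A.S i
      else H.filter fun i => e ∉ A.S i := by
  simp only [lightT, op_decide_bind_ite, val_bind, val_filter, val_length, val_op, val_pure]

theorem length_lightT_le (H : List (Fin m)) (e : Fin n) :
    (A.lightT H e).val.length ≤ H.length := by
  rw [val_lightT]
  split_ifs <;> exact List.length_filter_le _ _

theorem nodup_lightT {H : List (Fin m)} (hH : H.Nodup) (e : Fin n) :
    (A.lightT H e).val.Nodup := by
  rw [val_lightT]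
  split_ifs <;> exact hH.filter _

theorem toFinset_lightT {H : List (Fin m)} (hH : H.Nodup) (e : Fin n) :
    (A.lightT H e).val.toFinset = A.light e H.toFinset := by
  have hc : ∀ p : Fin m → Prop, [DecidablePred p] →
      (H.toFinset.filter p).card = (H.filter fun i => p i).length := by
    intro p _
    rw [← List.toFinset_card_of_nodup (hH.filter _), List.toFinset_filter]
    simp
  rw [val_lightT, light, hc, hc]
  split_ifs <;> simp [List.toFinset_filter]

theorem steps_lightT_le (H : List (Fin m)) (e : Fin n) :
    (A.lightT H e).steps ≤ 6 * H.length + 5 := by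
  have h1 := steps_filter_le (fun i => op (decide (e ∈ A.S i))) 1 H (fun _ => le_rfl)
  have h2 := steps_filter_le (fun i => op (decide (e ∉ A.S i))) 1 H (fun _ => le_rfl)
  have h3 := List.length_filter_le (fun i => decide (e ∈ A.S i)) H
  have h4 := List.length_filter_le (fun i => decide (e ∉ A.S i)) H
  simp only [lightT, op_decide_bind_ite, steps_bind, steps_length, val_filter, val_op,
    steps_pure, ite_self]
  omega

/-- Lists stand for sets of scenarios; absence of duplicates makes list sums and lengths agree with
sums and cardinalities over finsets. -/
theorem val_scoreT (E : Finset (Fin n)) {H : List (Fin m)} (hH : H.Nodup) (e : Fin n) :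
    (A.scoreT E H e).val = A.score E H.toFinset e := by
  simp only [scoreT, val_bind, val_op, val_sum, score]
  rw [← A.toFinset_lightT hH, List.sum_toFinset _ (A.nodup_lightT hH e),
    List.sum_toFinset _ hH]

theorem steps_scoreT_le (E : Finset (Fin n)) (H : List (Fin m)) (e : Fin n) :
    (A.scoreT E H e).steps ≤ 15 * H.length + 11 := by
  have h1 := A.steps_lightT_le H e
  have h2 := A.length_lightT_le H e
  have h3 := steps_sum_le (fun j => op (A.p j)) 1 (A.lightT H e).val (fun _ => le_rfl)
  have h4 := steps_sum_le (fun i => do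
    let x ← op (A.f i (insert e E))
    let y ← op (A.f i E)
    let d ← op (x - y)
    let r ← op (1 - y)
    let q ← op (d / r)
    op (A.p i * q)) 6 H (fun _ => le_rfl)
  simp only [scoreT, steps_bind, steps_op, val_op]
  omega

/-- Unfolds the match on the recursive result once, for both the value and the step count. -/
theorem bestT_cons (E : Finset (Fin n)) (H : List (Fin m)) (e : Fin n) (R : List (Fin n)) :
    ((A.bestT E H R).val = none →
      (A.bestT E H (e :: R)).val = some (e, (A.scoreT E H e).val)) ∧
    (∀ b, (A.bestT E H R).val = some b → (A.bestT E H (e :: R)).val =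
      if b.2 ≤ (A.scoreT E H e).val then some (e, (A.scoreT E H e).val) else some b) ∧
    (A.bestT E H (e :: R)).steps ≤ (A.scoreT E H e).steps + (A.bestT E H R).steps + 2 := by
  simp only [bestT, val_bind, steps_bind]
  rcases (A.bestT E H R).val with _ | ⟨e', s'⟩
  · simp [val_op, steps_op]
    omega
  · simp [val_bind, steps_bind, val_op, steps_op]
    omega

theorem val_bestT (E : Finset (Fin n)) {H : List (Fin m)} (hH : H.Nodup) (R : List (Fin n)) :
    ((A.bestT E H R).val = none → R = []) ∧
    ∀ b, (A.bestT E H R).val = some b → b.1 ∈ R ∧ b.2 = A.score E H.toFinset b.1 ∧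
      ∀ e ∈ R, A.score E H.toFinset e ≤ b.2 := by
  induction R with
  | nil => simp [bestT, val_op]
  | cons e R ih =>
    obtain ⟨h1, h2, -⟩ := A.bestT_cons E H e R
    rw [A.val_scoreT E hH] at h1 h2
    rcases hb : (A.bestT E H R).val with _ | b'
    · rw [h1 hb, ih.1 hb]
      simp
    · rw [h2 b' hb]
      obtain ⟨h3, h4, h5⟩ := ih.2 b' hb
      split_ifs with hle
      · refine ⟨by simp, ?_⟩
        rintro b ⟨rfl⟩
        refine ⟨by simp, rfl, fun e' he' => ?_⟩
        rcases List.mem_cons.1 he' with rfl | he'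
        · exact le_rfl
        · exact (h5 e' he').trans hle
      · refine ⟨by simp, ?_⟩
        rintro b ⟨rfl⟩
        refine ⟨List.mem_cons_of_mem _ h3, h4, fun e' he' => ?_⟩
        rcases List.mem_cons.1 he' with rfl | he'
        · exact (not_le.1 hle).le
        · exact h5 e' he'

theorem steps_bestT_le (E : Finset (Fin n)) (H : List (Fin m)) (R : List (Fin n)) :
    (A.bestT E H R).steps ≤ (15 * H.length + 13) * R.length + 1 := by
  induction R with
  | nil => simp [bestT, steps_op]
  | cons e R ih =>
    have h1 := (A.bestT_cons E H e R).2.2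
    have h2 := A.steps_scoreT_le E H e
    rw [List.length_cons]
    linarith

/-- The uncovered scenarios of `H` that agree with the feedback `b` about `e`. -/
noncomputable def nextAlive (E : Finset (Fin n)) (H : List (Fin m)) (e : Fin n) (b : Bool) :
    List (Fin m) :=
  (H.filter fun i => decide (e ∈ A.S i) == b).filter fun i => decide (A.f i (insert e E) < 1)

theorem length_nextAlive_le (E : Finset (Fin n)) (H : List (Fin m)) (e : Fin n) (b : Bool) :
    (A.nextAlive E H e b).length ≤ H.length :=
  (List.length_filter_le _ _).trans (List.length_filter_le _ _)

theorem val_runT_nil (feedback : Fin n → Bool) (k : ℕ) (E : Finset (Fin n)) :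
    (A.runT feedback k E []).val = [] := by
  cases k <;> rfl

theorem runT_cons (feedback : Fin n → Bool) (k : ℕ) (E : Finset (Fin n)) (i : Fin m)
    (H : List (Fin m)) :
    A.runT feedback (k + 1) E (i :: H) = (do
      let _ ← op false
      let R ← Timed.filter (fun e => op (decide (e ∉ E))) (List.finRange n)
      let best ← A.bestT E (i :: H) R
      match best with
      | none => op []
      | some (e, _) => do
        let b ← op (feedback e)
        let E' ← op (insert e E)
        let H₁ ← Timed.filter (fun i => op (decide (e ∈ A.S i) == b)) (i :: H)
        let H₂ ← Timed.filter (fun i => do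
          let v ← op (A.f i E')
          op (decide (v < 1))) H₁
        let l ← A.runT feedback k E' H₂
        op (e :: l)) := rfl

theorem val_runT_succ (feedback : Fin n → Bool) (k : ℕ) (E : Finset (Fin n)) {H : List (Fin m)}
    (hH : H ≠ []) :
    (A.runT feedback (k + 1) E H).val =
      match (A.bestT E H ((List.finRange n).filter fun e => decide (e ∉ E))).val with
      | none => []
      | some b => b.1 :: (A.runT feedback k (insert b.1 E)
          (A.nextAlive E H b.1 (feedback b.1))).val := by
  obtain ⟨i, H, rfl⟩ := List.exists_cons_of_ne_nil hH
  simp only [runT_cons, val_bind, val_filter, val_op]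
  rcases (A.bestT E (i :: H) ((List.finRange n).filter fun e => decide (e ∉ E))).val with _ | ⟨e, s⟩
  · rfl
  · simp only [val_bind, val_op, val_filter]
    rfl

theorem length_runT_le (feedback : Fin n → Bool) (k : ℕ) (E : Finset (Fin n))
    (H : List (Fin m)) : (A.runT feedback k E H).val.length ≤ k := by
  induction k generalizing E H with
  | zero => simp [runT, val_op]
  | succ k ih =>
    by_cases hH : H = []
    · subst hH
      simp [val_runT_nil]
    · rw [A.val_runT_succ feedback k E hH]
      split
      · simp
      · simpa using ih _ _

/-- A round costs at most 2n + 1 for the candidates, (15M + 13)n + 1 for the best one, 2M + 1 and 3M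
+ 1 for the two filters, and 4 single operations. The final 2 pays for the emptiness test and the
empty list. -/
theorem steps_runT_le (feedback : Fin n → Bool) (k : ℕ) (E : Finset (Fin n))
    (H : List (Fin m)) {M : ℕ} (hM : H.length ≤ M) :
    (A.runT feedback k E H).steps ≤ ((15 * M + 15) * n + 5 * M + 8) * k + 2 := by
  induction k generalizing E H with
  | zero => simp [runT, steps_op]
  | succ k ih =>
    rcases H with _ | ⟨i, H⟩
    · change 2 ≤ _
      omega
    · simp only [runT_cons, steps_bind, steps_op, val_filter, val_op]
      generalize i :: H = H at hM ⊢
      have h1 := steps_filter_le (fun e => op (decide (e ∉ E))) 1 (List.finRange n)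
        (fun _ => le_rfl)
      have h2 := A.steps_bestT_le E H ((List.finRange n).filter fun e => decide (e ∉ E))
      have h3 := List.length_filter_le (fun e => decide (e ∉ E)) (List.finRange n)
      rw [List.length_finRange] at h1 h3
      have h4 : (15 * H.length + 13) * ((List.finRange n).filter fun e => decide (e ∉ E)).length
          ≤ (15 * M + 13) * n := Nat.mul_le_mul (by omega) h3
      rcases (A.bestT E H ((List.finRange n).filter fun e => decide (e ∉ E))).val with _ | ⟨e, s⟩
      · simp only [steps_op]
        nlinarith
      · simp only [steps_bind, steps_op, val_op, val_filter, val_bind]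
        have h5 := steps_filter_le (fun i => op (decide (e ∈ A.S i) == feedback e)) 1 H
          (fun _ => le_rfl)
        have h6 := steps_filter_le (fun i => do
          let v ← op (A.f i (insert e E))
          op (decide (v < 1))) 2 (H.filter fun i => decide (e ∈ A.S i) == feedback e)
          (fun _ => le_rfl)
        have h7 := List.length_filter_le (fun i => decide (e ∈ A.S i) == feedback e) H
        have h8 := ih (insert e E) (A.nextAlive E H e (feedback e))
          ((A.length_nextAlive_le E H e _).trans hM)
        -- The nesting follows the binds of a round; the isolated ones are its single operations.
        refine (Nat.add_le_add_left (Nat.add_le_add h1 (Nat.add_le_add h2 (Nat.add_le_add_left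
          (Nat.add_le_add_left (Nat.add_le_add h5 (Nat.add_le_add h6
            (Nat.add_le_add_right h8 1))) 1) 1))) 1).trans ?_
        linarith

end ASRInstance

/-! ### Correctness and step count of the deterministic algorithm -/

namespace DSRInstance

open Timed

variable {n m : ℕ} (I : DSRInstance n m)

theorem nextAlive_toASR (E : Finset (Fin n)) (H : List (Fin m)) (e : Fin n) :
    I.toASR.nextAlive E H e true = H.filter fun i => decide (I.f i (insert e E) < 1) := by
  simp [ASRInstance.nextAlive, toASR]
  rfl

/-- The run with positive feedback traces the path of a greedy tree and displays distinct new
elements. -/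
theorem exists_isGreedyTree_runT (k : ℕ) (E : Finset (Fin n)) (H : List (Fin m))
    (hH : H.Nodup) (hf : ∀ i ∈ H, I.f i E < 1) (hk : (Finset.univ \ E).card ≤ k) :
    (∃ T, I.toASR.IsGreedyTree E H.toFinset T ∧
      T.path Finset.univ = (I.toASR.runT (fun _ => true) k E H).val) ∧
    (I.toASR.runT (fun _ => true) k E H).val.Nodup ∧
    ∀ e ∈ (I.toASR.runT (fun _ => true) k E H).val, e ∉ E := by
  induction k generalizing E H with
  | zero =>
    have hE : E = Finset.univ := by
      rw [Nat.le_zero, Finset.card_eq_zero, Finset.sdiff_eq_empty_iff_subset] at hk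
      exact Finset.univ_subset_iff.1 hk
    have hnil : H = [] := by
      rw [List.eq_nil_iff_forall_not_mem]
      intro i hi
      have := hf i hi
      rw [hE, I.f_univ] at this
      exact lt_irrefl _ this
    subst hnil
    rw [ASRInstance.val_runT_nil]
    exact ⟨⟨.leaf, .leaf E, rfl⟩, List.nodup_nil, by simp⟩
  | succ k ih =>
    by_cases hnil : H = []
    · subst hnil
      rw [ASRInstance.val_runT_nil]
      exact ⟨⟨.leaf, .leaf E, rfl⟩, List.nodup_nil, by simp⟩
    · rw [I.toASR.val_runT_succ _ k E hnil]
      obtain ⟨h1, h2⟩ := I.toASR.val_bestT E hH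
        ((List.finRange n).filter fun e => decide (e ∉ E))
      rcases hb : (I.toASR.bestT E H
        ((List.finRange n).filter fun e => decide (e ∉ E))).val with _ | ⟨e, s⟩
      -- Running out of candidates means that `E` is everything, so all functions are covered, while
      -- `H` still holds an uncovered one.
      · exfalso
        have h3 := h1 hb
        have hE : E = Finset.univ := by
          ext x
          have := (List.eq_nil_iff_forall_not_mem.1 h3) x
          simpa using this
        obtain ⟨i, hi⟩ := List.exists_mem_of_ne_nil H hnil
        have := hf i hi
        rw [hE, I.f_univ] at this
        exact lt_irrefl _ this
      · obtain ⟨h3, h4, h5⟩ := h2 _ hb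
        have he : e ∉ E := by simpa using h3
        simp only [nextAlive_toASR]
        obtain ⟨⟨T, hT, hpath⟩, hnd, hnew⟩ := ih (insert e E)
          (H.filter fun i => decide (I.f i (insert e E) < 1)) (hH.filter _)
          (fun i hi => by simpa using (List.mem_filter.1 hi).2) (by
            have h6 : Finset.univ \ insert e E ⊂ Finset.univ \ E := by
              refine Finset.ssubset_iff_subset_ne.2
                ⟨Finset.sdiff_subset_sdiff le_rfl (Finset.subset_insert e E), fun h => ?_⟩
              have : e ∈ Finset.univ \ insert e E := by
                rw [h]
                simp [he]
              simp at this
            have := Finset.card_lt_card h6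
            omega)
        refine ⟨⟨.node e T .leaf, ?_, ?_⟩, ?_, ?_⟩
        · refine .node E _ e T .leaf ?_ he (fun e' he' => ?_) ?_ ?_
          · rwa [List.toFinset_nonempty_iff]
          · have := h5 e' (by simpa using he')
            rwa [h4] at this
          · convert hT using 1
            ext i
            simp [toASR]
          -- No scenario is left on the no-branch, because every interest set is full.
          · convert ASRInstance.IsGreedyTree.leaf (insert e E) using 1
            simp [toASR]
        · simp [DecisionTree.path, hpath]
        · refine List.nodup_cons.2 ⟨fun h => ?_, hnd⟩
          exact hnew e h (Finset.mem_insert_self e E)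
        · intro x hx
          rcases List.mem_cons.1 hx with rfl | hx
          · exact he
          · exact fun h => hnew x hx (Finset.mem_insert_of_mem h)

theorem isGreedyOrdering_algorithm : I.IsGreedyOrdering I.algorithm.val := by
  obtain ⟨⟨T, hT, hpath⟩, hnd, -⟩ := I.exists_isGreedyTree_runT n ∅ (List.finRange m)
    (List.nodup_finRange m) (fun i _ => by simp [I.f_empty]) (by simp)
  have hval : I.algorithm.val = (I.toASR.runT (fun _ => true) n ∅ (List.finRange m)).val ++
      (List.finRange n).filter fun e =>
        decide (e ∉ (I.toASR.runT (fun _ => true) n ∅ (List.finRange m)).val) := by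
    simp only [algorithm, val_bind, val_op, val_filter]
  rw [hval]
  refine ⟨⟨?_, fun e => ?_⟩, T, ?_, fun i => ?_⟩
  · refine List.nodup_append.2 ⟨hnd, (List.nodup_finRange n).filter _, ?_⟩
    rintro a ha b hb rfl
    simp [ha] at hb
  · by_cases he : e ∈ (I.toASR.runT (fun _ => true) n ∅ (List.finRange m)).val
    · exact List.mem_append_left _ he
    · exact List.mem_append_right _ (by simp [he])
  · convert hT using 1
    simp
  · change T.path Finset.univ <+: _
    rw [hpath]
    exact List.prefix_append _ _

theorem steps_algorithm_le : I.algorithm.steps ≤ 100 * (n + m) ^ 3 := by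
  have h1 := I.toASR.steps_runT_le (fun _ => true) n ∅ (List.finRange m)
    (M := m) (by simp)
  have h2 := I.toASR.length_runT_le (fun _ => true) n ∅ (List.finRange m)
  -- Needed to absorb the constant steps: the bound vanishes at n = m = 0.
  have hm : 1 ≤ m := by
    rcases Nat.eq_zero_or_pos m with rfl | h
    · have := I.w_sum_pos
      simp at this
    · exact h
  simp only [algorithm, steps_bind, steps_op, val_filter, tick]
  have h3 := steps_filter_le (fun e => do
    Timed.tick (I.toASR.runT (fun _ => true) n ∅ (List.finRange m)).val.length
    Timed.op (decide (e ∉ (I.toASR.runT (fun _ => true) n ∅ (List.finRange m)).val))) (n + 1)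
    (List.finRange n) (fun e => by
      simp only [steps_bind, steps_op, tick]
      omega)
  rw [List.length_finRange] at h3
  simp only [tick] at h3
  have h4 : n + n * m + m + m + m + ((15 * m + 15) * n + 5 * m + 8) * n + 2
      + ((n + 1 + 1) * n + 1) + n + 1 ≤ 100 * (n + m) ^ 3 := by
    obtain ⟨m, rfl⟩ := Nat.exists_eq_add_of_le' hm
    ring_nf
    nlinarith [Nat.zero_le (n * m), Nat.zero_le (n * m ^ 2), Nat.zero_le (n ^ 2 * m),
      Nat.zero_le (n ^ 3), Nat.zero_le (m ^ 3), Nat.zero_le (m ^ 2), Nat.zero_le (n ^ 2)]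
  omega

end DSRInstance

theorem mainTheorem8 :
    ∃ C : ℝ, 0 < C ∧ ∃ K d : ℕ, ∀ (n m : ℕ) (I : DSRInstance n m),
      -- in the associated adaptive instance, `L_e(H)` is always empty
      (∀ (e : Fin n) (H : Finset (Fin m)), I.toASR.light e H = ∅) ∧
      -- the approximation guarantee, for every way of breaking ties
      (∀ l, I.IsGreedyOrdering l → ∀ l', IsLinearOrdering l' →
        I.objective l ≤ C * (1 + Real.log (1 / I.epsilon)) * I.objective l') ∧
      -- the implementation returns such an ordering in polynomially many steps
      I.IsGreedyOrdering I.algorithm.val ∧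
      I.algorithm.steps ≤ K * (n + m) ^ d :=
  ⟨4, by norm_num, 100, 3, fun _ _ I => ⟨I.light_toASR,
    fun _ hl _ hl' => DSRInstance.IsGreedyOrdering.objective_le I hl hl',
    I.isGreedyOrdering_algorithm, I.steps_algorithm_le⟩⟩
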